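/- Consider a branching random walk on $\mathbb Z$ started by one particle at the origin. In each generation every particle first jumps according to a law $(a_y)_{y\in\mathbb Z}$ and then, at its new position, is replaced by a random number of children with law $(p_k)_{k\ge 0}$; all jumps and offspring numbers are independent. The vertices of the genealogical tree are the root, placed at $0$, and for each particle its children, placed where that particle has landed after its jump. Let $M$ be the supremum of the positions of all vertices of the tree, and $u(n)=P(M\ge n)$. Assume that the offspring law has mean $m\in(0,1)$ and a finite third moment, and that the jump law has mean zero and finite variance, is not the point mass at $0$, and satisfies $K(\theta):=\sum_{y\in\mathbb Z}a_y\theta^y<\infty$ for all $\theta\ge 1$. Then there is exactly one $\rho>1$ with $K(\rho)=1/m$, and $\ell(n):=\rho^n u(n)$ has the following properties. (a) $0<\liminf_{n\to\infty}\ell(n)\le\limsup_{n\to\infty}\ell(n)\le 1$. (b) If moreover there is an integer $R\ge1$ such that $a_i>0$ for $i=1,\dots,R$ and $a_k=0$ for all $k>R$, then there is $\kappa\in(0,1]$ with $\lim_{n\to\infty}\ell(n)=\kappa$. (c) In all cases, with or without the additional assumption in (b), $\log\rho=-\lim_{n\to\infty}\frac1n\log E\big(m^{\tau_n}\big)$,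 where $\tau_n=\min\{j\ge 0: W_j\ge n\}$ and $(W_j)_{j\ge0}$ is a random walk with $W_0=0$ and independent steps with law $(a_y)$ (with $m^{\infty}=0$). -/

import Mathlib

open MeasureTheory ProbabilityTheory Filter Topology

namespace BRW

/-- The generating function `K(θ) = ∑_y a_y θ^y` of the jump law `a` on `ℤ`. -/
noncomputable def jumpPgf (a : PMF ℤ) (θ : ℝ) : ℝ :=
  ∑' y : ℤ, (a y).toReal * θ ^ y

/-- The jump law has mean zero and finite variance, is not the point mass at `0`, and its
generating function is finite on `[1, ∞)`. -/
structure JumpLaw (a : PMF ℤ) : Prop where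
  mean_zero : HasSum (fun y : ℤ => (a y).toReal * (y : ℝ)) 0
  finite_variance : Summable fun y : ℤ => (a y).toReal * (y : ℝ) ^ 2
  nondegenerate : a 0 ≠ 1
  pgf_finite : ∀ θ : ℝ, 1 ≤ θ → Summable fun y : ℤ => (a y).toReal * θ ^ y

/-- The offspring law has mean `m ∈ (0, 1)` and a finite third moment. -/
structure OffspringLaw (p : PMF ℕ) (m : ℝ) : Prop where
  mean : HasSum (fun k : ℕ => (p k).toReal * (k : ℝ)) m
  mean_pos : 0 < m
  mean_lt_one : m < 1
  third_moment : Summable fun k : ℕ => (p k).toReal * (k : ℝ) ^ 3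

/-- Right range exactly `R > 0`. -/
def HasRightRange (a : PMF ℤ) (R : ℕ) : Prop :=
  0 < R ∧ a (R : ℤ) ≠ 0 ∧ ∀ k : ℤ, (R : ℤ) < k → a k = 0

/-- Given the right range `R`: every jump size `1, …, R` has positive probability. -/
def NearlyRightContinuous (a : PMF ℤ) (R : ℕ) : Prop :=
  ∀ i : ℕ, 1 ≤ i → i ≤ R → a (i : ℤ) ≠ 0

section Tree

variable {Ω : Type*}

/-- The Galton-Watson tree in Ulam-Harris labelling. The root is `[]`, the `i`-th child of the
vertex `v` is `i :: v`, and `offspring v` is the number of children of `v`. The generation of a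
vertex is its length. -/
def InTree (offspring : List ℕ → Ω → ℕ) (ω : Ω) : List ℕ → Prop
  | [] => True
  | i :: v => InTree offspring ω v ∧ i < offspring v ω

/-- Positions: the root is at `0`; the particle `v` first makes the jump `jump v` and then
reproduces, so that all children of `v` are born at the place where `v` has landed. -/
def position (jump : List ℕ → Ω → ℤ) (ω : Ω) : List ℕ → ℤ
  | [] => 0
  | _ :: v => position jump ω v + jump v ω

/-- `M_n`: the rightmost position reached up to generation `n`. -/
noncomputable def maxUpTo (jump : List ℕ → Ω → ℤ) (offspring : List ℕ → Ω → ℕ) (n : ℕ)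
    (ω : Ω) : EReal :=
  ⨆ v ∈ {v : List ℕ | InTree offspring ω v ∧ v.length ≤ n}, ((position jump ω v : ℝ) : EReal)

/-- `M`: the rightmost position ever reached. -/
noncomputable def maxEver (jump : List ℕ → Ω → ℤ) (offspring : List ℕ → Ω → ℕ)
    (ω : Ω) : EReal :=
  ⨆ n : ℕ, maxUpTo jump offspring n ω

/-- `u(x) = P(M ≥ x)`. -/
noncomputable def tailProb [MeasurableSpace Ω] (P : Measure Ω) (jump : List ℕ → Ω → ℤ)
    (offspring : List ℕ → Ω → ℕ) (x : ℤ) : ℝ :=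
  P.real {ω | ((x : ℝ) : EReal) ≤ maxEver jump offspring ω}

/-- The jumps have law `a`, the offspring numbers have law `p`, and all of them are
independent. -/
structure IsDrivenBy [MeasurableSpace Ω] (P : Measure Ω) (a : PMF ℤ) (p : PMF ℕ)
    (jump : List ℕ → Ω → ℤ) (offspring : List ℕ → Ω → ℕ) : Prop where
  measurable_jump : ∀ v, Measurable (jump v)
  measurable_offspring : ∀ v, Measurable (offspring v)
  law : ∀ v, P.map (fun ω => (jump v ω, offspring v ω)) = a.toMeasure.prod p.toMeasure
  indep : iIndepFun (fun v ω => (jump v ω, offspring v ω)) P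

end Tree

section Walk

variable {Ω : Type*}

/-- The random walk `W` with steps `Y 0, Y 1, …`, started at `0`. -/
def walk (Y : ℕ → Ω → ℤ) (n : ℕ) (ω : Ω) : ℤ := ∑ i ∈ Finset.range n, Y i ω

/-- `τ_y = min {n ≥ 0 : W_n ≥ y}`, equal to `⊤` if the level `y` is never reached. -/
noncomputable def passageTime (Y : ℕ → Ω → ℤ) (y : ℤ) : Ω → WithTop ℕ :=
  hittingAfter (walk Y) (Set.Ici y) 0

/-- `m ^ t` for `t ∈ ℕ ∪ {∞}` and `0 < m < 1`, with `m ^ ∞ = 0`. -/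
def powTop (m : ℝ) : WithTop ℕ → ℝ
  | none => 0
  | some k => m ^ k

/-- The steps are independent with law `a`. -/
structure IsIIDSteps [MeasurableSpace Ω] (P : Measure Ω) (a : PMF ℤ)
    (Y : ℕ → Ω → ℤ) : Prop where
  measurable : ∀ i, Measurable (Y i)
  law : ∀ i, P.map (Y i) = a.toMeasure
  indep : iIndepFun Y P

end Walk

end BRW

/-!
Splitting the tree at the root shows that the tail probability `u(n) = P(M ≥ n)` satisfies
`u(n) = ∑ y, α_y Q(u(n - y))` for `n > 0` and `u(n) = 1` for `n ≤ 0`, where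
`Q(s) = 1 - ∑ k, p_k (1 - s) ^ k` satisfies `m s - C s² ≤ Q(s) ≤ m s` and is increasing and
`m`-Lipschitz (`isTailSolution_tailProb`, `isDamping_survivalMap`). Similarly `v(n) = E m ^ τ_n`
solves the same equation with `Q(s)` replaced by `m s` (`isTailSolution_integral_powTop`). Because
`m < 1`, the equation is a contraction in the supremum norm, which gives a comparison principle
for sub- and supersolutions whose difference is bounded above, without any random walk argument
(`nonpos_of_le_contraction`).

* `ρ ^ (-n)` solves the linear equation, since `m K(ρ) = 1`, and it is at least `1` for `n ≤ 0`;
  hence `u(n) ≤ v(n) ≤ ρ ^ (-n)`.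
* By convexity `m K(ρ²) > 1`. The function `ρ ^ (-2 n)` therefore gains under the linear operator,
  and this pays for the quadratic defect `C s²`: the truncation of `ε (ρ ^ (-n) + ρ ^ (-2 n))` at
  `1` is a subsolution, so `u(n) ≥ ε ρ ^ (-n)` for `n > 0`. The two bounds give the
  liminf and limsup statements and the rate of `v`.
* For the limit, `ℓ(n) = ρ ^ n u(n)` is at most an average of the values `ℓ(n - y)`, `y ≤ R`, with
  weights `m α_y ρ ^ y` that are positive for `1 ≤ y ≤ R`. Where `ℓ` nearly attains its limsup, it is
  therefore nearly maximal on the whole window of the preceding `R` sites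
  (`IsTailSolution.near_max_spreads`). As `u(n) - B ρ ^ (-2 n)` is a supersolution of the linear
  equation and no jump exceeds `R`, this lower bound persists to the right of the window
  (`IsTailSolution.lower_bound_propagates`), so the liminf equals the limsup.
-/

/-! ### Tail equations and the comparison principle -/

/-- The properties of the map `Q(s) = 1 - ∑ k, p_k (1 - s) ^ k` on `[0, 1]` that the analysis of
`u(n) = ∑ y, α_y Q(u(n - y))` uses; the linear map `s ↦ m s` has them too. -/
structure IsDamping (Q : ℝ → ℝ) (m C : ℝ) : Prop where
  map_zero : Q 0 = 0
  mono : ∀ s t, 0 ≤ s → s ≤ t → t ≤ 1 → Q s ≤ Q t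
  lip : ∀ s t, 0 ≤ s → s ≤ t → t ≤ 1 → Q t - Q s ≤ m * (t - s)
  lower : ∀ s, 0 ≤ s → s ≤ 1 → m * s - C * s ^ 2 ≤ Q s

/-- `u` takes values in `[0, 1]`, equals `1` on `(-∞, 0]`, and solves
`u(n) = ∑ y, α_y Q(u(n - y))` for `n > 0`. -/
structure IsTailSolution (α : ℤ → ℝ) (Q : ℝ → ℝ) (u : ℤ → ℝ) : Prop where
  nonneg : ∀ n, 0 ≤ u n
  le_one : ∀ n, u n ≤ 1
  eq_one : ∀ n, n ≤ 0 → u n = 1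
  hasSum : ∀ n, 0 < n → HasSum (fun y => α y * Q (u (n - y))) (u n)

lemma IsDamping.le_mul {Q : ℝ → ℝ} {m C : ℝ} (hQ : IsDamping Q m C) {s : ℝ} (h0 : 0 ≤ s)
    (h1 : s ≤ 1) : Q s ≤ m * s := by
  have := hQ.lip 0 s le_rfl h0 h1
  rw [hQ.map_zero] at this
  simpa using this

lemma isDamping_linear {m : ℝ} (hm : 0 ≤ m) : IsDamping (fun s => m * s) m 0 where
  map_zero := by simp
  mono s t _ h _ := mul_le_mul_of_nonneg_left h hm
  lip s t _ _ _ := by linarith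
  lower s _ _ := by simp

/-- The quadratic lower bound survives truncating the argument at `1`, since for `g ≥ 1` it is
nonpositive once `m ≤ C`. -/
lemma IsDamping.lower_min {Q : ℝ → ℝ} {m C : ℝ} (hQ : IsDamping Q m C) (hC : m ≤ C)
    (hC0 : 0 ≤ C) {g : ℝ} (hg : 0 ≤ g) : m * g - C * g ^ 2 ≤ Q (min 1 g) := by
  rcases le_total g 1 with h | h
  · rw [min_eq_right h]; exact hQ.lower g hg h
  · rw [min_eq_left h]
    have h1 := hQ.mono 0 1 le_rfl zero_le_one le_rfl
    rw [hQ.map_zero] at h1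
    nlinarith [mul_le_mul_of_nonneg_right hC hg, mul_nonneg (mul_nonneg hC0 hg) (sub_nonneg.2 h)]

lemma IsDamping.sub_le {Q : ℝ → ℝ} {m C : ℝ} (hQ : IsDamping Q m C) (hm : 0 ≤ m) {s t : ℝ}
    (hs : 0 ≤ s) (hs1 : s ≤ 1) (ht : 0 ≤ t) (ht1 : t ≤ 1) : Q s - Q t ≤ m * max (s - t) 0 := by
  rcases le_total s t with h | h
  · have := hQ.mono s t hs h ht1
    have h2 : 0 ≤ m * max (s - t) 0 := mul_nonneg hm (le_max_right _ _)
    linarith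
  · rw [max_eq_left (sub_nonneg.2 h)]
    exact hQ.lip t s ht h hs1

/-- Comparison principle. Since `m < 1`, the operator `d ↦ m ∑ y, α_y d⁺(· - y)` contracts the
supremum norm, so a function that is bounded above and dominated by its own image wherever it is
positive is nowhere positive. -/
theorem nonpos_of_le_contraction {α : ℤ → ℝ} (h0 : ∀ y, 0 ≤ α y) (h1 : HasSum α 1) {m : ℝ}
    (hm0 : 0 ≤ m) (hm1 : m < 1) {d : ℤ → ℝ} {B : ℝ} (hB : ∀ k, d k ≤ B)
    (h : ∀ k, 0 < d k → ∃ (e : ℤ → ℝ) (S : ℝ), HasSum (fun y => α y * e y) S ∧ d k ≤ m * S ∧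
      ∀ y, α y ≠ 0 → e y ≤ max (d (k - y)) 0) (k : ℤ) : d k ≤ 0 := by
  have key : ∀ j : ℕ, ∀ k, d k ≤ m ^ j * max B 0 := by
    intro j
    induction j with
    | zero => intro k; simpa using Or.inl (hB k)
    | succ j ih =>
      intro k
      have hnn : 0 ≤ m ^ j * max B 0 := mul_nonneg (pow_nonneg hm0 _) (le_max_right _ _)
      rcases le_or_gt (d k) 0 with hk | hk
      · exact hk.trans (mul_nonneg (pow_nonneg hm0 _) (le_max_right _ _))
      obtain ⟨e, S, hS, hle, he⟩ := h k hk
      have hS' : S ≤ 1 * (m ^ j * max B 0) := by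
        refine hasSum_le (fun y => ?_) hS (h1.mul_right _)
        by_cases hy : α y = 0
        · simp [hy]
        · exact mul_le_mul_of_nonneg_left ((he y hy).trans (max_le (ih _) hnn)) (h0 y)
      calc d k ≤ m * S := hle
        _ ≤ m * (1 * (m ^ j * max B 0)) := mul_le_mul_of_nonneg_left hS' hm0
        _ = m ^ (j + 1) * max B 0 := by ring
  have hlim : Tendsto (fun j : ℕ => m ^ j * max B 0) atTop (𝓝 (0 * max B 0)) :=
    (tendsto_pow_atTop_nhds_zero_of_lt_one hm0 hm1).mul_const _
  rw [zero_mul] at hlim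
  exact ge_of_tendsto' hlim fun j => key j k

lemma hasSum_zpow_shift {α : ℤ → ℝ} {θ S : ℝ} (hθ : 0 < θ) (h : HasSum (fun y => α y * θ ^ y) S)
    (n : ℤ) : HasSum (fun y => α y * θ ^ (-(n - y))) (θ ^ (-n) * S) := by
  have h2 := h.mul_left (θ ^ (-n))
  have : (fun y => α y * θ ^ (-(n - y))) = fun y => θ ^ (-n) * (α y * θ ^ y) := by
    funext y
    rw [show -(n - y) = -n + y by ring, zpow_add₀ hθ.ne']
    ring
  rwa [this]

/-- A tail solution is at most `ρ ^ (-n)`, which solves the linearized equation. -/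
theorem IsTailSolution.le_zpow {α : ℤ → ℝ} (h0 : ∀ y, 0 ≤ α y) (h1 : HasSum α 1) {m C : ℝ}
    (hm0 : 0 < m) (hm1 : m < 1) {Q : ℝ → ℝ} (hQ : IsDamping Q m C) {u : ℤ → ℝ}
    (hu : IsTailSolution α Q u) {ρ : ℝ} (hρ : 1 < ρ) (hK : HasSum (fun y => α y * ρ ^ y) (1 / m))
    (n : ℤ) : u n ≤ ρ ^ (-n) := by
  have hρ0 : 0 < ρ := one_pos.trans hρ
  suffices h : u n - ρ ^ (-n) ≤ 0 by linarith
  refine nonpos_of_le_contraction h0 h1 hm0.le hm1 (d := fun n => u n - ρ ^ (-n)) (B := 1)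
    (fun k => ?_) (fun k hk => ?_) n
  · have := hu.le_one k
    have := zpow_pos hρ0 (-k)
    linarith
  · have hk0 : 0 < k := by
      by_contra hcon
      have h2 : (1 : ℝ) ≤ ρ ^ (-k) := one_le_zpow₀ hρ.le (by omega)
      have h3 := hu.le_one k
      linarith
    refine ⟨fun y => Q (u (k - y)) / m - ρ ^ (-(k - y)), u k / m - ρ ^ (-k) * (1 / m), ?_, ?_, ?_⟩
    · have := ((hu.hasSum k hk0).div_const m).sub (hasSum_zpow_shift hρ0 hK k)
      refine (congrArg (fun f => HasSum f _) (funext fun y => ?_)).mp this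
      ring
    · refine le_of_eq ?_
      field_simp
    · intro y _
      have h4 := hQ.le_mul (hu.nonneg (k - y)) (hu.le_one (k - y))
      have h5 : Q (u (k - y)) / m ≤ u (k - y) := by rw [div_le_iff₀ hm0]; linarith
      exact le_max_of_le_left (by linarith)

/-- The tail solution for `Q` lies below the one for the linear map `s ↦ m s`. -/
theorem IsTailSolution.le_linear {α : ℤ → ℝ} (h0 : ∀ y, 0 ≤ α y) (h1 : HasSum α 1) {m C : ℝ}
    (hm0 : 0 < m) (hm1 : m < 1) {Q : ℝ → ℝ} (hQ : IsDamping Q m C) {u v : ℤ → ℝ}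
    (hu : IsTailSolution α Q u) (hv : IsTailSolution α (fun s => m * s) v) (n : ℤ) :
    u n ≤ v n := by
  suffices h : u n - v n ≤ 0 by linarith
  refine nonpos_of_le_contraction h0 h1 hm0.le hm1 (d := fun n => u n - v n) (B := 1)
    (fun k => ?_) (fun k hk => ?_) n
  · have := hu.le_one k
    have := hv.nonneg k
    linarith
  · have hk0 : 0 < k := by
      by_contra hcon
      have h2 := hv.eq_one k (by omega)
      have h3 := hu.le_one k
      linarith
    refine ⟨fun y => Q (u (k - y)) / m - v (k - y), u k / m - v k / m, ?_, ?_, ?_⟩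
    · have := ((hu.hasSum k hk0).div_const m).sub ((hv.hasSum k hk0).div_const m)
      refine (congrArg (fun f => HasSum f _) (funext fun y => ?_)).mp this
      field_simp
    · refine le_of_eq ?_
      field_simp
    · intro y _
      have h4 := hQ.le_mul (hu.nonneg (k - y)) (hu.le_one (k - y))
      have h5 : Q (u (k - y)) / m ≤ u (k - y) := by rw [div_le_iff₀ hm0]; linarith
      exact le_max_of_le_left (by linarith)

/-- A tail solution is at least a multiple of `ρ ^ (-n)`: for small `ε` the truncation at `1` of
`ε (ρ ^ (-n) + ρ ^ (-2 n))` is a subsolution, because the second term gains the factor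
`m K(ρ²) > 1`, which pays for the quadratic defect of `Q`. -/
theorem IsTailSolution.exists_mul_zpow_le {α : ℤ → ℝ} (h0 : ∀ y, 0 ≤ α y) (h1 : HasSum α 1)
    {m C : ℝ} (hm0 : 0 < m) (hm1 : m < 1) {Q : ℝ → ℝ} (hQ : IsDamping Q m C) (hC : m ≤ C)
    {u : ℤ → ℝ} (hu : IsTailSolution α Q u) {ρ K₂ K₄ : ℝ} (hρ : 1 < ρ)
    (hK : HasSum (fun y => α y * ρ ^ y) (1 / m))
    (hK₂ : HasSum (fun y => α y * (ρ ^ 2) ^ y) K₂) (hK₄ : HasSum (fun y => α y * (ρ ^ 4) ^ y) K₄)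
    (hlt : 1 < m * K₂) : ∃ ε : ℝ, 0 < ε ∧ ∀ n : ℤ, 0 < n → ε * ρ ^ (-n) ≤ u n := by
  have hρ0 : 0 < ρ := one_pos.trans hρ
  have hC0 : 0 < C := hm0.trans_le hC
  have hK₂0 : 0 < K₂ := by
    by_contra hcon
    nlinarith
  have hK₄0 : 0 ≤ K₄ := hK₄.nonneg fun y => mul_nonneg (h0 y) (zpow_nonneg (by positivity) _)
  -- `g² ≤ 2 ε² (ρ ^ (-2 n) + ρ ^ (-4 n))`, so the quadratic defect is at most
  -- `2 C ε² (K₂ + K₄) ρ ^ (-2 k)`, to be paid for by the gain `ε (m K₂ - 1) ρ ^ (-2 k)`.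
  obtain ⟨ε, hε0, hε1, hε⟩ : ∃ ε : ℝ, 0 < ε ∧ ε ≤ 1 ∧
      2 * C * ε * (K₂ + K₄) ≤ m * K₂ - 1 := by
    refine ⟨min 1 ((m * K₂ - 1) / (2 * C * (K₂ + K₄))), ?_, min_le_left _ _, ?_⟩
    · exact lt_min one_pos (div_pos (by linarith) (by positivity))
    · have := min_le_right (1 : ℝ) ((m * K₂ - 1) / (2 * C * (K₂ + K₄)))
      rw [le_div_iff₀ (by positivity)] at this
      linarith
  set g : ℤ → ℝ := fun n => ε * (ρ ^ (-n) + (ρ ^ 2) ^ (-n)) with hg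
  have hg0 : ∀ n, 0 ≤ g n := fun n => by positivity
  have hgu : ∀ n, min 1 (g n) - u n ≤ 0 := by
    refine nonpos_of_le_contraction h0 h1 hm0.le hm1 (B := 1)
      (fun k => ?_) (fun k hk => ?_)
    · have := hu.nonneg k
      have := min_le_left 1 (g k)
      linarith
    · have hk0 : 0 < k := by
        by_contra hcon
        have h2 := hu.eq_one k (by omega)
        have h3 := min_le_left 1 (g k)
        linarith
      refine ⟨fun y => ε * ρ ^ (-(k - y)) + ε * (ρ ^ 2) ^ (-(k - y))
          - 2 * C * ε ^ 2 / m * (ρ ^ 2) ^ (-(k - y)) - 2 * C * ε ^ 2 / m * (ρ ^ 4) ^ (-(k - y))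
          - Q (u (k - y)) / m,
        ε * (ρ ^ (-k) * (1 / m)) + ε * ((ρ ^ 2) ^ (-k) * K₂)
          - 2 * C * ε ^ 2 / m * ((ρ ^ 2) ^ (-k) * K₂) - 2 * C * ε ^ 2 / m * ((ρ ^ 4) ^ (-k) * K₄)
          - u k / m, ?_, ?_, ?_⟩
      · have e1 := hasSum_zpow_shift hρ0 hK k
        have e2 := hasSum_zpow_shift (by positivity) hK₂ k
        have e4 := hasSum_zpow_shift (by positivity) hK₄ k
        have := ((((e1.mul_left ε).add (e2.mul_left ε)).sub
          (e2.mul_left (2 * C * ε ^ 2 / m))).sub (e4.mul_left (2 * C * ε ^ 2 / m))).sub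
          ((hu.hasSum k hk0).div_const m)
        refine (congrArg (fun f => HasSum f _) (funext fun y => ?_)).mp this
        ring
      · have h2 : (ρ ^ 4) ^ (-k) ≤ (ρ ^ 2) ^ (-k) := by
          rw [zpow_neg, zpow_neg]
          have : ρ ^ 2 ≤ ρ ^ 4 := pow_le_pow_right₀ hρ.le (by norm_num)
          have := zpow_le_zpow_left₀ hk0.le (by positivity) this
          exact inv_anti₀ (by positivity) this
        have h3 : 0 < (ρ ^ 2) ^ (-k) := by positivity
        have h4 : m * (ε * (ρ ^ (-k) * (1 / m)) + ε * ((ρ ^ 2) ^ (-k) * K₂)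
          - 2 * C * ε ^ 2 / m * ((ρ ^ 2) ^ (-k) * K₂) - 2 * C * ε ^ 2 / m * ((ρ ^ 4) ^ (-k) * K₄)
          - u k / m) = ε * ρ ^ (-k) + ε * (m * K₂) * (ρ ^ 2) ^ (-k)
            - 2 * C * ε ^ 2 * K₂ * (ρ ^ 2) ^ (-k) - 2 * C * ε ^ 2 * K₄ * (ρ ^ 4) ^ (-k) - u k := by
          field_simp
        rw [h4]
        have h5 := min_le_right 1 (g k)
        have h6 : 2 * C * ε ^ 2 * K₄ * (ρ ^ 4) ^ (-k) ≤ 2 * C * ε ^ 2 * K₄ * (ρ ^ 2) ^ (-k) :=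
          mul_le_mul_of_nonneg_left h2 (by positivity)
        have h7 := mul_le_mul_of_nonneg_left hε (mul_nonneg hε0.le h3.le)
        simp only [hg] at h5 ⊢
        nlinarith
      · intro y _
        simp only
        generalize k - y = j
        have h2 := hQ.lower_min hC hC0.le (hg0 j)
        have h3 := hQ.sub_le hm0.le (le_min zero_le_one (hg0 j)) (min_le_left _ _)
          (hu.nonneg j) (hu.le_one j)
        have h4 : g j ^ 2 ≤ 2 * ε ^ 2 * (ρ ^ 2) ^ (-j) + 2 * ε ^ 2 * (ρ ^ 4) ^ (-j) := by
          have e2 : (ρ ^ 2) ^ (-j) = (ρ ^ (-j)) ^ 2 := by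
            rw [← zpow_natCast, ← zpow_natCast, ← zpow_mul, ← zpow_mul]; ring_nf
          have e4 : (ρ ^ 4) ^ (-j) = (ρ ^ (-j)) ^ 4 := by
            rw [← zpow_natCast, ← zpow_natCast, ← zpow_mul, ← zpow_mul]; ring_nf
          simp only [hg]
          rw [e2, e4]
          nlinarith [sq_nonneg (ε * (ρ ^ (-j) - (ρ ^ (-j)) ^ 2))]
        have h5 := mul_le_mul_of_nonneg_left h4 hC0.le
        refine le_of_mul_le_mul_left ?_ hm0
        refine le_trans (le_of_eq ?_) (le_trans (?_ : m * g j - C * (2 * ε ^ 2 * (ρ ^ 2) ^ (-j)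
          + 2 * ε ^ 2 * (ρ ^ 4) ^ (-j)) - Q (u j) ≤ _) h3)
        · simp only [hg]
          field_simp
          ring
        · linarith
  refine ⟨ε, hε0, fun n hn => ?_⟩
  have h2 : ρ ^ (-n) ≤ 1 := zpow_le_one_of_nonpos₀ hρ.le (by omega)
  have h3 : 0 < ρ ^ (-n) := zpow_pos hρ0 _
  have h4 : ε * ρ ^ (-n) ≤ min 1 (g n) := by
    refine le_min (by nlinarith) ?_
    have : 0 < (ρ ^ 2) ^ (-n) := by positivity
    simp only [hg]
    nlinarith
  linarith [hgu n]

/-! ### Convergence for nearly right-continuous jumps -/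

/-- Minimum principle on a half-line. The correction `B ρ ^ (-2 k)` turns `u` into a supersolution
of the linear equation, so a lower bound `c ρ ^ (-j)` for it on a window of length `R`, the largest
jump, propagates to the right of the window. -/
theorem IsTailSolution.lower_bound_propagates {α : ℤ → ℝ} (h0 : ∀ y, 0 ≤ α y) (h1 : HasSum α 1)
    {m C : ℝ} (hm0 : 0 < m) (hm1 : m < 1) {Q : ℝ → ℝ} (hQ : IsDamping Q m C) (hC : m ≤ C)
    {u : ℤ → ℝ} (hu : IsTailSolution α Q u) {ρ K₂ B : ℝ} (hρ : 1 < ρ)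
    (hK : HasSum (fun y => α y * ρ ^ y) (1 / m)) (hK₂ : HasSum (fun y => α y * (ρ ^ 2) ^ y) K₂)
    (hB : C * K₂ ≤ B * (m * K₂ - 1)) {R : ℕ}
    (hR : ∀ y : ℤ, (R : ℤ) < y → α y = 0) {n : ℤ} (hn : 0 < n) {c : ℝ}
    (hw : ∀ j, n - R ≤ j → j < n → c * ρ ^ (-j) + B * (ρ ^ 2) ^ (-j) ≤ u j) (k : ℤ) (hk : n ≤ k) :
    c * ρ ^ (-k) + B * (ρ ^ 2) ^ (-k) ≤ u k := by
  have hρ0 : 0 < ρ := one_pos.trans hρ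
  have hC0 : 0 < C := hm0.trans_le hC
  have key := nonpos_of_le_contraction h0 h1 hm0.le hm1
    (d := fun k => if k < n then 0 else c * ρ ^ (-k) + B * (ρ ^ 2) ^ (-k) - u k)
    (B := |c| + |B|) ?_ ?_ k
  · rw [if_neg (not_lt.2 hk)] at key
    linarith
  · intro k
    split_ifs with h
    · positivity
    · have e1 : ρ ^ (-k) ≤ 1 := zpow_le_one_of_nonpos₀ hρ.le (by omega)
      have e2 : (ρ ^ 2) ^ (-k) ≤ 1 := zpow_le_one_of_nonpos₀ (one_le_pow₀ hρ.le) (by omega)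
      have e3 : 0 < ρ ^ (-k) := by positivity
      have e4 : 0 < (ρ ^ 2) ^ (-k) := by positivity
      have := hu.nonneg k
      nlinarith [mul_le_mul_of_nonneg_right (le_abs_self c) e3.le,
        mul_le_mul_of_nonneg_right (le_abs_self B) e4.le,
        mul_le_mul_of_nonneg_left e1 (abs_nonneg c), mul_le_mul_of_nonneg_left e2 (abs_nonneg B)]
  · intro k hk
    by_cases hkn : k < n
    · simp [hkn] at hk
    simp only [hkn, if_false] at hk ⊢
    -- `u` is bounded by `Q(u) / m` plus the quadratic defect because `∑ y, α_y Q(u(k - y)) = u(k)`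
    -- is a known sum; the defect is absorbed in the coefficient `B - C / m`.
    refine ⟨fun y => c * ρ ^ (-(k - y)) + (B - C / m) * (ρ ^ 2) ^ (-(k - y)) - Q (u (k - y)) / m,
      c * (ρ ^ (-k) * (1 / m)) + (B - C / m) * ((ρ ^ 2) ^ (-k) * K₂) - u k / m, ?_, ?_, ?_⟩
    · have e1 := hasSum_zpow_shift hρ0 hK k
      have e2 := hasSum_zpow_shift (by positivity) hK₂ k
      have := ((e1.mul_left c).add (e2.mul_left (B - C / m))).sub
          ((hu.hasSum k (by omega)).div_const m)
      refine (congrArg (fun f => HasSum f _) (funext fun y => ?_)).mp this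
      ring
    · have h3 : 0 < (ρ ^ 2) ^ (-k) := by positivity
      have h4 : m * (c * (ρ ^ (-k) * (1 / m)) + (B - C / m) * ((ρ ^ 2) ^ (-k) * K₂) - u k / m)
          = c * ρ ^ (-k) + (m * B - C) * K₂ * (ρ ^ 2) ^ (-k) - u k := by
        field_simp
      rw [h4]
      have : B * (ρ ^ 2) ^ (-k) ≤ (m * B - C) * K₂ * (ρ ^ 2) ^ (-k) :=
        mul_le_mul_of_nonneg_right (by linarith) h3.le
      linarith
    · intro y hy
      have hyR : y ≤ R := by
        by_contra hcon
        exact hy (hR y (by omega))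
      have hj : c * ρ ^ (-(k - y)) + (B - C / m) * (ρ ^ 2) ^ (-(k - y)) - Q (u (k - y)) / m
          ≤ c * ρ ^ (-(k - y)) + B * (ρ ^ 2) ^ (-(k - y)) - u (k - y) := by
        have h2 := hQ.lower _ (hu.nonneg (k - y)) (hu.le_one (k - y))
        have h3 : u (k - y) ^ 2 ≤ (ρ ^ 2) ^ (-(k - y)) := by
          have := hu.le_zpow h0 h1 hm0 hm1 hQ hρ hK (k - y)
          have e2 : (ρ ^ 2) ^ (-(k - y)) = (ρ ^ (-(k - y))) ^ 2 := by
            rw [← zpow_natCast, ← zpow_natCast, ← zpow_mul, ← zpow_mul]; ring_nf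
          rw [e2]
          exact pow_le_pow_left₀ (hu.nonneg _) this 2
        have h4 := mul_le_mul_of_nonneg_left h3 hC0.le
        have h5 : u (k - y) ≤ (Q (u (k - y)) + C * (ρ ^ 2) ^ (-(k - y))) / m := by
          rw [le_div_iff₀ hm0]; linarith
        have h6 : (Q (u (k - y)) + C * (ρ ^ 2) ^ (-(k - y))) / m
          = Q (u (k - y)) / m + C / m * (ρ ^ 2) ^ (-(k - y)) := by ring
        linarith
      by_cases hkn' : k - y < n
      · have := hw (k - y) (by omega) hkn'
        exact le_max_of_le_right (by linarith)
      · rw [if_neg hkn']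
        exact le_max_of_le_left hj

/-- A near-maximal value of `ρ ^ n u(n)` forces near-maximal values at the sites `n - i` from which
a jump `i` with `α_i > 0` leads to `n`, since `ρ ^ n u(n)` is at most an average of such values with
weights `m α_y ρ ^ y`. -/
theorem IsTailSolution.near_max_spreads {α : ℤ → ℝ} (h0 : ∀ y, 0 ≤ α y)
    {m C : ℝ} (hm0 : 0 < m) {Q : ℝ → ℝ} (hQ : IsDamping Q m C)
    {u : ℤ → ℝ} (hu : IsTailSolution α Q u) {ρ : ℝ} (hρ : 1 < ρ)
    (hK : HasSum (fun y => α y * ρ ^ y) (1 / m)) {R : ℕ}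
    (hR : ∀ y : ℤ, (R : ℤ) < y → α y = 0) {n : ℤ} (hn : 0 < n) {L η : ℝ}
    (hsup : ∀ j, n - R ≤ j → ρ ^ j * u j ≤ L + η) (hmax : L - η ≤ ρ ^ n * u n) (i : ℤ) :
    m * α i * ρ ^ i * (L + η - ρ ^ (n - i) * u (n - i)) ≤ 2 * η := by
  have hρ0 : 0 < ρ := one_pos.trans hρ
  have hsum := (((hasSum_zpow_shift hρ0 hK n).mul_left (m * (L + η))).sub (hu.hasSum n hn))
  have hj : ∀ y, α y * (m * ((L + η) * ρ ^ (-(n - y)) - u (n - y))) ≤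
      m * (L + η) * (α y * ρ ^ (-(n - y))) - α y * Q (u (n - y)) := by
    intro y
    have := mul_le_mul_of_nonneg_left (hQ.le_mul (hu.nonneg (n - y)) (hu.le_one (n - y))) (h0 y)
    linarith
  have hnn : ∀ y, 0 ≤ α y * (m * ((L + η) * ρ ^ (-(n - y)) - u (n - y))) := by
    intro y
    by_cases hy : α y = 0
    · simp [hy]
    have hyR : y ≤ R := by
      by_contra hcon
      exact hy (hR y (by omega))
    have h2 := hsup (n - y) (by omega)
    have h3 : u (n - y) ≤ (L + η) * ρ ^ (-(n - y)) := by
      rw [zpow_neg, ← div_eq_mul_inv, le_div_iff₀ (zpow_pos hρ0 _)]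
      linarith
    exact mul_nonneg (h0 y) (mul_nonneg hm0.le (by linarith))
  have h4 := (hj i).trans (le_hasSum hsum i fun y _ => (hnn y).trans (hj y))
  have h5 := mul_le_mul_of_nonneg_left h4 (zpow_pos hρ0 n).le
  have e1 : ρ ^ n * ρ ^ (-n) = 1 := by rw [← zpow_add₀ hρ0.ne']; simp
  have e2 : ρ ^ n * ρ ^ (-(n - i)) = ρ ^ i := by rw [← zpow_add₀ hρ0.ne']; ring_nf
  have e3 : ρ ^ i * ρ ^ (n - i) = ρ ^ n := by rw [← zpow_add₀ hρ0.ne']; ring_nf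
  have h6 : ρ ^ n * (α i * (m * ((L + η) * ρ ^ (-(n - i)) - u (n - i)))) =
      m * α i * ρ ^ i * (L + η - ρ ^ (n - i) * u (n - i)) := by
    calc _ = m * α i * ((L + η) * (ρ ^ n * ρ ^ (-(n - i))) - ρ ^ n * u (n - i)) := by ring
      _ = _ := by rw [e2, ← e3]; ring
  have h7 : ρ ^ n * (m * (L + η) * (ρ ^ (-n) * (1 / m)) - u n) = L + η - ρ ^ n * u n := by
    calc _ = (L + η) * (ρ ^ n * ρ ^ (-n)) * (m * (1 / m)) - ρ ^ n * u n := by ring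
      _ = _ := by rw [e1, mul_one_div_cancel hm0.ne']; ring
  rw [h6, h7] at h5
  linarith

/-- If all jumps `1, …, R` are possible and `R` is the largest jump, then `ρ ^ n u(n)` converges:
near a point where it almost attains its limsup it is almost maximal on a whole window, and the
minimum principle carries this lower bound to infinity. -/
theorem IsTailSolution.exists_tendsto {α : ℤ → ℝ} (h0 : ∀ y, 0 ≤ α y) (h1 : HasSum α 1)
    {m C : ℝ} (hm0 : 0 < m) (hm1 : m < 1) {Q : ℝ → ℝ} (hQ : IsDamping Q m C) (hC : m ≤ C)
    {u : ℤ → ℝ} (hu : IsTailSolution α Q u) {ρ K₂ : ℝ} (hρ : 1 < ρ)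
    (hK : HasSum (fun y => α y * ρ ^ y) (1 / m)) (hK₂ : HasSum (fun y => α y * (ρ ^ 2) ^ y) K₂)
    (hlt : 1 < m * K₂) {R : ℕ} (hR0 : 0 < R) (hR : ∀ y : ℤ, (R : ℤ) < y → α y = 0)
    (hpos : ∀ i : ℕ, 1 ≤ i → i ≤ R → 0 < α i) :
    ∃ L : ℝ, Tendsto (fun n : ℤ => ρ ^ n * u n) atTop (𝓝 L) := by
  have hρ0 : 0 < ρ := one_pos.trans hρ
  have hC0 : 0 < C := hm0.trans_le hC
  set l : ℤ → ℝ := fun n => ρ ^ n * u n with hl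
  have hl0 : ∀ n, 0 ≤ l n := fun n => mul_nonneg (zpow_pos hρ0 _).le (hu.nonneg n)
  have hl1 : ∀ n, l n ≤ 1 := fun n => by
    have := mul_le_mul_of_nonneg_left (hu.le_zpow h0 h1 hm0 hm1 hQ hρ hK n) (zpow_pos hρ0 n).le
    rwa [← zpow_add₀ hρ0.ne', add_neg_cancel, zpow_zero] at this
  have hbd : IsBoundedUnder (· ≤ ·) atTop l := isBoundedUnder_of ⟨1, hl1⟩
  have hbd' : IsBoundedUnder (· ≥ ·) atTop l := isBoundedUnder_of ⟨0, hl0⟩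
  set L := limsup l atTop with hL
  have hup : ∀ η > 0, ∀ᶠ n in atTop, l n < L + η := fun η hη =>
    eventually_lt_of_limsup_lt (by linarith) hbd
  have hfr : ∀ η > 0, ∃ᶠ n in atTop, L - η < l n := fun η hη =>
    frequently_lt_of_lt_limsup hbd'.isCoboundedUnder_le (by linarith)
  obtain ⟨β, hβ0, hβ⟩ : ∃ β > 0, ∀ i : ℕ, 1 ≤ i → i ≤ R → β ≤ m * α i * ρ ^ (i : ℤ) := by
    obtain ⟨i₀, hi₀, hmin⟩ := Finset.exists_min_image (Finset.Icc 1 R)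
      (fun i : ℕ => m * α i * ρ ^ (i : ℤ)) ⟨1, Finset.mem_Icc.2 ⟨le_rfl, hR0⟩⟩
    rw [Finset.mem_Icc] at hi₀
    refine ⟨m * α i₀ * ρ ^ (i₀ : ℤ),
      mul_pos (mul_pos hm0 (hpos i₀ hi₀.1 hi₀.2)) (zpow_pos hρ0 _), fun i h1 h2 => ?_⟩
    exact hmin i (Finset.mem_Icc.2 ⟨h1, h2⟩)
  set B := C * K₂ / (m * K₂ - 1) with hBdef
  have hB : C * K₂ ≤ B * (m * K₂ - 1) := by
    rw [hBdef, div_mul_cancel₀]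
    linarith
  have hBnn : 0 ≤ B := by
    have : 0 < K₂ := by
      by_contra hcon
      nlinarith
    exact div_nonneg (by positivity) (by linarith)
  have hBlim : Tendsto (fun n : ℤ => B * ρ ^ (-n)) atTop (𝓝 (B * 0)) := by
    refine Tendsto.const_mul B ?_
    have h2 : Tendsto (fun n : ℤ => ρ ^ n) atTop atTop := by
      refine tendsto_atTop_atTop_of_monotone (zpow_right_mono₀ hρ.le) fun b => ?_
      obtain ⟨k, hk⟩ := pow_unbounded_of_one_lt b hρ
      exact ⟨k, by rw [zpow_natCast]; exact hk.le⟩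
    simp only [zpow_neg]
    exact h2.inv_tendsto_atTop
  rw [mul_zero] at hBlim
  refine ⟨L, Metric.tendsto_atTop.2 fun δ hδ => ?_⟩
  obtain ⟨N₁, hN₁⟩ := eventually_atTop.1 (hup δ hδ)
  -- Spreading turns an error `η` at `n` into at most `2 η / β` on the window.
  set η := min (δ / 3) (β * (δ / 3) / 2) with hη
  have hη0 : 0 < η := lt_min (by positivity) (by positivity)
  obtain ⟨N₂, hN₂⟩ := eventually_atTop.1 (hup η hη0)
  obtain ⟨N₃, hN₃⟩ := eventually_atTop.1 ((tendsto_order.1 hBlim).2 (δ / 3) (by positivity))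
  obtain ⟨n, hn, hnl⟩ := frequently_atTop.1 (hfr η hη0) (max (max N₂ N₃ + R) (1 + max N₁ 0))
  have hwin : ∀ j, n - R ≤ j → j < n → (L - 2 * δ / 3) * ρ ^ (-j) + B * (ρ ^ 2) ^ (-j) ≤ u j := by
    intro j hj1 hj2
    obtain ⟨i, hi⟩ : ∃ i : ℕ, j = n - i := ⟨(n - j).toNat, by omega⟩
    have h2 := hu.near_max_spreads h0 hm0 hQ hρ hK hR (n := n) (by omega) (L := L) (η := η)
      (fun j hj => (hN₂ j (by omega)).le) hnl.le i
    rw [← hi] at h2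
    have h3 := hN₂ j (by omega)
    have h4 : β * (L + η - l j) ≤ 2 * η :=
      (mul_le_mul_of_nonneg_right (hβ i (by omega) (by omega)) (by linarith)).trans h2
    have h5 : 2 * η ≤ β * (δ / 3) := by
      have := min_le_right (δ / 3) (β * (δ / 3) / 2)
      linarith
    have h6 : L + η - l j ≤ δ / 3 := le_of_mul_le_mul_left (h4.trans h5) hβ0
    have h7 := hN₃ j (by omega)
    have h8 : L - 2 * δ / 3 + B * ρ ^ (-j) ≤ l j := by linarith
    have h9 := mul_le_mul_of_nonneg_right h8 (zpow_pos hρ0 (-j)).le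
    have e1 : l j * ρ ^ (-j) = u j := by
      simp only [hl]
      rw [mul_right_comm, ← zpow_add₀ hρ0.ne', add_neg_cancel, zpow_zero, one_mul]
    have e2 : (ρ ^ 2) ^ (-j) = ρ ^ (-j) * ρ ^ (-j) := by
      rw [← mul_zpow, ← pow_two]
    rw [e1] at h9
    rw [e2]
    linarith
  refine ⟨n, fun k hk => ?_⟩
  have h2 := hu.lower_bound_propagates h0 h1 hm0 hm1 hQ hC hρ hK hK₂ hB hR (by omega) hwin k hk
  have h3 : L - 2 * δ / 3 ≤ l k := by
    have h4 : 0 ≤ B * (ρ ^ 2) ^ (-k) := mul_nonneg hBnn (by positivity)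
    have h5 : (L - 2 * δ / 3) * ρ ^ (-k) ≤ u k := by linarith
    rw [zpow_neg, ← div_eq_mul_inv, div_le_iff₀ (zpow_pos hρ0 _)] at h5
    simp only [hl]
    linarith
  have h4 := hN₁ k (by omega)
  rw [Real.dist_eq, abs_lt]
  constructor <;> linarith

/-! ### The offspring law -/

lemma hasSum_toReal_pmf {β : Type*} (p : PMF β) : HasSum (fun k => (p k).toReal) 1 := by
  have := ENNReal.hasSum_toReal (p.tsum_coe.trans_ne ENNReal.one_ne_top)
  rwa [← ENNReal.tsum_toReal_eq fun k => p.apply_ne_top k, p.tsum_coe, ENNReal.toReal_one] at this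

/-- `1 - f(1 - s)` for the offspring generating function `f`: the probability that at least one
child is marked when each child is marked independently with probability `s`. -/
noncomputable def survivalMap (p : PMF ℕ) (s : ℝ) : ℝ := 1 - ∑' k, (p k).toReal * (1 - s) ^ k

lemma summable_pmf_mul_pow (p : PMF ℕ) {q : ℝ} (h0 : 0 ≤ q) (h1 : q ≤ 1) :
    Summable fun k => (p k).toReal * q ^ k :=
  (hasSum_toReal_pmf p).summable.of_nonneg_of_le
    (fun _ => mul_nonneg ENNReal.toReal_nonneg (pow_nonneg h0 _))
    fun _ => mul_le_of_le_one_right ENNReal.toReal_nonneg (pow_le_one₀ h0 h1)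

lemma hasSum_survivalMap (p : PMF ℕ) {s : ℝ} (h0 : 0 ≤ s) (h1 : s ≤ 1) :
    HasSum (fun k => (p k).toReal * (1 - (1 - s) ^ k)) (survivalMap p s) := by
  have := (hasSum_toReal_pmf p).sub
    (summable_pmf_mul_pow p (q := 1 - s) (by linarith) (by linarith)).hasSum
  simp only [mul_sub, mul_one]
  exact this

lemma pow_sub_pow_le_mul {x y : ℝ} (hy : 0 ≤ y) (hxy : y ≤ x) (hx : x ≤ 1) (k : ℕ) :
    x ^ k - y ^ k ≤ k * (x - y) := by
  induction k with
  | zero => simp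
  | succ k ih =>
    have h1 : x ^ k ≤ 1 := pow_le_one₀ (hy.trans hxy) hx
    have h2 : y * (x ^ k - y ^ k) ≤ x ^ k - y ^ k :=
      mul_le_of_le_one_left (sub_nonneg.2 (pow_le_pow_left₀ hy hxy k)) (hxy.trans hx)
    have h3 := mul_le_mul_of_nonneg_right h1 (sub_nonneg.2 hxy)
    push_cast
    calc x ^ (k + 1) - y ^ (k + 1) = x ^ k * (x - y) + y * (x ^ k - y ^ k) := by ring
      _ ≤ _ := by linarith

lemma one_sub_pow_le_quadratic {s : ℝ} (h0 : 0 ≤ s) (h1 : s ≤ 1) (k : ℕ) :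
    (1 - s) ^ k ≤ 1 - k * s + (k : ℝ) ^ 2 * s ^ 2 := by
  induction k with
  | zero => simp
  | succ k ih =>
    have h2 := mul_le_mul_of_nonneg_right ih (sub_nonneg.2 h1)
    have h3 : 0 ≤ (k : ℝ) ^ 2 * s ^ 3 := by positivity
    have h4 : 0 ≤ (k + 1 : ℝ) * s ^ 2 := by positivity
    push_cast
    rw [pow_succ]
    nlinarith

lemma isDamping_survivalMap {p : PMF ℕ} {m : ℝ} (hp : BRW.OffspringLaw p m) :
    IsDamping (survivalMap p) m (m + ∑' k : ℕ, (p k).toReal * (k : ℝ) ^ 2) where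
  map_zero := by
    have := hasSum_survivalMap p (s := 0) le_rfl zero_le_one
    simp only [sub_zero, one_pow, sub_self, mul_zero] at this
    exact this.unique hasSum_zero
  mono s t h0 hst h1 := by
    refine hasSum_le (fun k => ?_) (hasSum_survivalMap p h0 (hst.trans h1))
      (hasSum_survivalMap p (h0.trans hst) h1)
    refine mul_le_mul_of_nonneg_left ?_ ENNReal.toReal_nonneg
    have := pow_le_pow_left₀ (sub_nonneg.2 h1) (by linarith : 1 - t ≤ 1 - s) k
    linarith
  lip s t h0 hst h1 := by
    refine hasSum_le (fun k => ?_) ((hasSum_survivalMap p (h0.trans hst) h1).sub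
      (hasSum_survivalMap p h0 (hst.trans h1))) (hp.mean.mul_right (t - s))
    rw [← mul_sub, mul_assoc]
    refine mul_le_mul_of_nonneg_left ?_ ENNReal.toReal_nonneg
    have := pow_sub_pow_le_mul (sub_nonneg.2 h1) (by linarith : 1 - t ≤ 1 - s) (by linarith) k
    linarith
  lower s h0 h1 := by
    have h2 : Summable fun k : ℕ => (p k).toReal * (k : ℝ) ^ 2 := by
      refine hp.third_moment.of_nonneg_of_le (fun k => by positivity) fun k => ?_
      refine mul_le_mul_of_nonneg_left ?_ ENNReal.toReal_nonneg
      rcases Nat.eq_zero_or_pos k with rfl | hk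
      · simp
      · exact pow_le_pow_right₀ (by exact_mod_cast hk) (by norm_num)
    have h3 : m * s - (∑' k : ℕ, (p k).toReal * (k : ℝ) ^ 2) * s ^ 2 ≤ survivalMap p s := by
      refine hasSum_le (fun k => ?_) ((hp.mean.mul_right s).sub (h2.hasSum.mul_right (s ^ 2)))
        (hasSum_survivalMap p h0 h1)
      have := mul_le_mul_of_nonneg_left (one_sub_pow_le_quadratic h0 h1 k)
        (ENNReal.toReal_nonneg (a := p k))
      linarith
    have h4 : 0 ≤ m * s ^ 2 := mul_nonneg hp.mean_pos.le (sq_nonneg _)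
    linarith

/-! ### The jump generating function -/

lemma hasSum_jumpPgf {a : PMF ℤ} (ha : BRW.JumpLaw a) {θ : ℝ} (hθ : 1 ≤ θ) :
    HasSum (fun y : ℤ => (a y).toReal * θ ^ y) (BRW.jumpPgf a θ) :=
  (ha.pgf_finite θ hθ).hasSum

lemma jumpPgf_one (a : PMF ℤ) : BRW.jumpPgf a 1 = 1 := by
  simpa [BRW.jumpPgf] using (hasSum_toReal_pmf a).tsum_eq

lemma exists_pos_jump {a : PMF ℤ} (ha : BRW.JumpLaw a) : ∃ y : ℤ, 0 < y ∧ 0 < (a y).toReal := by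
  by_contra! hcon
  have hz : ∀ y : ℤ, 0 < y → (a y).toReal = 0 := fun y hy =>
    le_antisymm (hcon y hy) ENNReal.toReal_nonneg
  have hneg : ∀ y : ℤ, 0 ≤ -((a y).toReal * (y : ℝ)) := by
    intro y
    rcases le_or_gt y 0 with hy | hy
    · have : (y : ℝ) ≤ 0 := by exact_mod_cast hy
      have h2 : 0 ≤ (a y).toReal := ENNReal.toReal_nonneg
      nlinarith
    · simp [hz y hy]
  have h0 : (fun y : ℤ => -((a y).toReal * (y : ℝ))) = 0 :=
    (hasSum_zero_iff_of_nonneg hneg).1 (by simpa using ha.mean_zero.neg)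
  have h1 : ∀ y : ℤ, y ≠ 0 → (a y).toReal = 0 := by
    intro y hy
    have := congrFun h0 y
    have hy' : (y : ℝ) ≠ 0 := by exact_mod_cast hy
    simpa [hy'] using this
  have h2 := (hasSum_single (0 : ℤ) h1).unique (hasSum_toReal_pmf a)
  refine ha.nondegenerate ?_
  rw [← ENNReal.toReal_eq_one_iff]
  exact h2

/-- `K` is convex with `K(1) = 1`, hence strictly increasing from the moment it exceeds `1`. -/
lemma jumpPgf_lt_of_lt {a : PMF ℤ} (ha : BRW.JumpLaw a) {s t : ℝ} (hs : 1 < s) (hst : s < t)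
    (hK : 1 < BRW.jumpPgf a s) : BRW.jumpPgf a s < BRW.jumpPgf a t := by
  by_contra! hcon
  set c := (t - s) / (t - 1) with hc
  have ht : 0 < t - 1 := by linarith
  have hc0 : 0 < c := div_pos (by linarith) ht
  have hc1 : 0 ≤ 1 - c := by
    rw [hc, sub_nonneg, div_le_one ht]; linarith
  have hcs : c * 1 + (1 - c) * t = s := by
    rw [hc]; field_simp; ring
  have hle : BRW.jumpPgf a s ≤ c * 1 + (1 - c) * BRW.jumpPgf a t := by
    refine hasSum_le (fun y => ?_) (hasSum_jumpPgf ha hs.le)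
      (((hasSum_toReal_pmf a).mul_left c).add ((hasSum_jumpPgf ha (hs.trans hst).le).mul_left _))
    have h2 := (convexOn_zpow y).2 (Set.mem_Ioi.2 (one_pos (α := ℝ)))
      (Set.mem_Ioi.2 (by linarith : 0 < t)) hc0.le hc1 (by ring)
    simp only [smul_eq_mul, one_zpow] at h2
    rw [hcs] at h2
    have := mul_le_mul_of_nonneg_left h2 (ENNReal.toReal_nonneg (a := a y))
    linarith
  nlinarith

lemma exists_jumpPgf_eq {a : PMF ℤ} (ha : BRW.JumpLaw a) {b : ℝ} (hb : 1 < b) :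
    ∃ ρ : ℝ, 1 < ρ ∧ BRW.jumpPgf a ρ = b := by
  obtain ⟨y, hy, hay⟩ := exists_pos_jump ha
  obtain ⟨T, hT1, hT⟩ : ∃ T : ℝ, 1 ≤ T ∧ b ≤ BRW.jumpPgf a T := by
    have h2 : 1 ≤ b / (a y).toReal := by
      rw [le_div_iff₀ hay, one_mul]
      exact (le_hasSum (hasSum_toReal_pmf a) y fun _ _ => ENNReal.toReal_nonneg).trans hb.le
    refine ⟨b / (a y).toReal, h2, ?_⟩
    have h3 : b / (a y).toReal ≤ (b / (a y).toReal) ^ y := by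
      simpa using zpow_le_zpow_right₀ h2 (show (1 : ℤ) ≤ y by omega)
    refine le_trans ?_ (le_hasSum (hasSum_jumpPgf ha h2) y fun _ _ =>
      mul_nonneg ENNReal.toReal_nonneg (by positivity))
    rwa [div_le_iff₀' hay] at h3
  have hcont : ContinuousOn (BRW.jumpPgf a) (Set.Icc 1 T) := by
    refine continuousOn_tsum (u := fun y : ℤ => (a y).toReal + (a y).toReal * T ^ y)
      (fun y => ?_) ((hasSum_toReal_pmf a).summable.add (ha.pgf_finite T hT1)) fun y θ hθ => ?_
    · refine continuousOn_const.mul (continuousOn_id.zpow₀ y fun θ hθ => Or.inl ?_)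
      exact (one_pos.trans_le hθ.1).ne'
    · have hθ0 : 0 < θ := one_pos.trans_le hθ.1
      rw [Real.norm_of_nonneg (mul_nonneg ENNReal.toReal_nonneg (zpow_pos hθ0 _).le), ← mul_one_add]
      refine mul_le_mul_of_nonneg_left ?_ ENNReal.toReal_nonneg
      rcases le_total 0 y with hy | hy
      · have := zpow_le_zpow_left₀ hy hθ0.le hθ.2
        linarith
      · have := zpow_le_one_of_nonpos₀ hθ.1 hy
        have h5 : 0 < T ^ y := zpow_pos (by linarith) _
        linarith
  obtain ⟨ρ, hρ, hKρ⟩ := intermediate_value_Icc hT1 hcont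
    ⟨by rw [jumpPgf_one]; exact hb.le, hT⟩
  refine ⟨ρ, lt_of_le_of_ne hρ.1 ?_, hKρ⟩
  rintro rfl
  rw [jumpPgf_one] at hKρ
  exact hb.ne hKρ

/-! ### The first-generation decomposition of the branching random walk -/

section Tree

variable {Ω : Type*} {jump : List ℕ → Ω → ℤ} {offspring : List ℕ → Ω → ℕ}

/-- Some vertex of the tree has position at least `n`. -/
def Reaches (jump : List ℕ → Ω → ℤ) (offspring : List ℕ → Ω → ℕ) (n : ℤ) (ω : Ω) : Prop :=
  ∃ v, BRW.InTree offspring ω v ∧ n ≤ BRW.position jump ω v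

lemma le_maxEver_iff (n : ℤ) (ω : Ω) :
    ((n : ℝ) : EReal) ≤ BRW.maxEver jump offspring ω ↔ Reaches jump offspring n ω := by
  constructor
  · intro h
    by_contra hcon
    have hle : BRW.maxEver jump offspring ω ≤ (((n - 1 : ℤ) : ℝ) : EReal) := by
      refine iSup_le fun k => iSup₂_le fun v hv => ?_
      have : BRW.position jump ω v ≤ n - 1 := by
        by_contra h2
        exact hcon ⟨v, hv.1, by omega⟩
      exact_mod_cast this
    have h3 := h.trans hle
    have h4 : n ≤ n - 1 := by exact_mod_cast h3
    omega
  · rintro ⟨v, hv, hn⟩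
    refine le_trans ?_ (le_iSup _ v.length)
    refine le_trans ?_ (le_iSup₂ (f := fun v _ => ((BRW.position jump ω v : ℝ) : EReal)) v
      ⟨hv, le_rfl⟩)
    exact_mod_cast hn

lemma measurableSet_reaches {mΩ : MeasurableSpace Ω} (hj : ∀ v, Measurable (jump v))
    (ho : ∀ v, Measurable (offspring v)) (n : ℤ) :
    MeasurableSet {ω | Reaches jump offspring n ω} := by
  have h1 : ∀ v, MeasurableSet {ω | BRW.InTree offspring ω v} := by
    intro v
    induction v with
    | nil => simp [BRW.InTree]
    | cons i v ih =>
      exact ih.inter (measurableSet_lt measurable_const (ho v))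
  have h2 : ∀ v, Measurable fun ω => BRW.position jump ω v := by
    intro v
    induction v with
    | nil => simp only [BRW.position]; exact measurable_const
    | cons i v ih => exact ih.add (hj v)
  have : {ω | Reaches jump offspring n ω} =
      ⋃ v, {ω | BRW.InTree offspring ω v} ∩ {ω | n ≤ BRW.position jump ω v} := by
    ext ω; simp [Reaches]
  rw [this]
  exact MeasurableSet.iUnion fun v => (h1 v).inter (measurableSet_le measurable_const (h2 v))

lemma inTree_append (i : ℕ) (v : List ℕ) (ω : Ω) : BRW.InTree offspring ω (v ++ [i]) ↔
    i < offspring [] ω ∧ BRW.InTree (fun w => offspring (w ++ [i])) ω v := by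
  induction v with
  | nil => simp [BRW.InTree]
  | cons j v ih => simp only [List.cons_append, BRW.InTree, ih, and_assoc]

lemma position_append (i : ℕ) (v : List ℕ) (ω : Ω) : BRW.position jump ω (v ++ [i]) =
    jump [] ω + BRW.position (fun w => jump (w ++ [i])) ω v := by
  induction v with
  | nil => simp [BRW.position]
  | cons j v ih => simp only [List.cons_append, BRW.position, ih, add_assoc]

/-- The vertices `v ++ [i]` form the subtree of the child `i` of the root, which is a tree of the
same kind, translated by the jump of the root. -/
lemma reaches_iff {n : ℤ} (hn : 0 < n) (ω : Ω) : Reaches jump offspring n ω ↔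
    ∃ i < offspring [] ω, Reaches (fun w => jump (w ++ [i])) (fun w => offspring (w ++ [i]))
      (n - jump [] ω) ω := by
  constructor
  · rintro ⟨v, hv, hnv⟩
    rcases List.eq_nil_or_concat v with rfl | ⟨w, i, rfl⟩
    · simp only [BRW.position] at hnv; omega
    · simp only [List.concat_eq_append] at hv hnv
      rw [inTree_append] at hv
      rw [position_append] at hnv
      exact ⟨i, hv.1, w, hv.2, by omega⟩
  · rintro ⟨i, hi, w, hw, hnw⟩
    exact ⟨w ++ [i], (inTree_append i w ω).2 ⟨hi, hw⟩, by rw [position_append]; omega⟩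

end Tree

/-- If the `σ`-algebras `m v` are independent, the index sets `T`, `S 0`, `S 1`, … are disjoint, `D`
depends on the indices in `T` and each `A i` on those in `S i`, then `D` and the `A i` are
independent. -/
lemma measureReal_inter_iInter_of_iIndep {Ω ι : Type*} [MeasurableSpace Ω] {P : Measure Ω}
    [IsProbabilityMeasure P] {m : ι → MeasurableSpace Ω} (hle : ∀ v, m v ≤ ‹MeasurableSpace Ω›)
    (hind : iIndep m P) {S : ℕ → Set ι} {T : Set ι} (hS : Pairwise fun i j => Disjoint (S i) (S j))
    (hT : ∀ i, Disjoint T (S i)) {D : Set Ω} (hD : MeasurableSet[⨆ v ∈ T, m v] D) {A : ℕ → Set Ω}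
    (hA : ∀ i, MeasurableSet[⨆ v ∈ S i, m v] (A i)) {q : ℝ} (hq : ∀ i, P.real (A i) = q) (j : ℕ) :
    P.real (D ∩ ⋂ i < j, A i) = P.real D * q ^ j := by
  have hmeas : ∀ j, MeasurableSet[⨆ v ∈ T ∪ ⋃ i < j, S i, m v] (D ∩ ⋂ i < j, A i) := by
    intro j
    have hDj : (⨆ v ∈ T, m v) ≤ ⨆ v ∈ T ∪ ⋃ i < j, S i, m v :=
      biSup_mono fun v hv => Or.inl hv
    refine MeasurableSet.inter (hDj _ hD) ?_
    refine MeasurableSet.biInter (Set.to_countable _) fun i hi => ?_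
    have hAj : (⨆ v ∈ S i, m v) ≤ ⨆ v ∈ T ∪ ⋃ i < j, S i, m v :=
      biSup_mono fun v hv => Or.inr (Set.mem_biUnion hi hv)
    exact hAj _ (hA i)
  induction j with
  | zero => simp
  | succ j ih =>
    have hdisj : Disjoint (T ∪ ⋃ i < j, S i) (S j) := by
      rw [Set.disjoint_union_left, Set.disjoint_iUnion₂_left]
      exact ⟨hT j, fun i hi => hS (ne_of_lt hi)⟩
    have hI := Indep_iff _ _ _ |>.1 (indep_iSup_of_disjoint hle hind hdisj) _ _ (hmeas j) (hA j)
    have hset : D ∩ ⋂ i < j + 1, A i = (D ∩ ⋂ i < j, A i) ∩ A j := by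
      rw [Set.biInter_lt_succ, Set.inter_assoc]
    rw [hset, measureReal_def, hI, ENNReal.toReal_mul, ← measureReal_def, ← measureReal_def, ih,
      hq, pow_succ, mul_assoc]

lemma hasSum_measureReal_inter_preimage {Ω β : Type*} [MeasurableSpace Ω] {P : Measure Ω}
    [IsProbabilityMeasure P] [Countable β] [MeasurableSpace β] [MeasurableSingletonClass β]
    {f : Ω → β} (hf : Measurable f) {A : Set Ω} (hA : MeasurableSet A) :
    HasSum (fun b => P.real (A ∩ f ⁻¹' {b})) (P.real A) := by
  have h1 : P A = ∑' b, P (A ∩ f ⁻¹' {b}) := by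
    rw [← measure_iUnion]
    · congr 1
      ext ω; simp
    · intro b c hbc
      refine Set.disjoint_left.2 ?_
      rintro ω ⟨_, hb⟩ ⟨_, hc⟩
      exact hbc (hb.symm.trans hc)
    · exact fun b => hA.inter (hf (measurableSet_singleton b))
  have h2 := ENNReal.hasSum_toReal (h1 ▸ measure_ne_top P A)
  rwa [← ENNReal.tsum_toReal_eq fun b => measure_ne_top P _, ← h1] at h2

section TreeLaw

variable {Ω : Type*} [MeasurableSpace Ω] {P : Measure Ω} {a : PMF ℤ} {p : PMF ℕ}
  {jump : List ℕ → Ω → ℤ} {offspring : List ℕ → Ω → ℕ}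

lemma isDrivenBy_subtree (h : BRW.IsDrivenBy P a p jump offspring) (i : ℕ) :
    BRW.IsDrivenBy P a p (fun w => jump (w ++ [i])) (fun w => offspring (w ++ [i])) where
  measurable_jump _ := h.measurable_jump _
  measurable_offspring _ := h.measurable_offspring _
  law _ := h.law _
  indep := h.indep.precomp (g := fun w => w ++ [i]) fun _ _ => List.append_cancel_right

lemma tailProb_eq (n : ℤ) :
    BRW.tailProb P jump offspring n = P.real {ω | Reaches jump offspring n ω} := by
  simp only [BRW.tailProb, le_maxEver_iff]

/-- The tail probability depends only on the laws: both families have the product law. -/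
lemma tailProb_eq_of_isDrivenBy (h : BRW.IsDrivenBy P a p jump offspring)
    {jump' : List ℕ → Ω → ℤ} {offspring' : List ℕ → Ω → ℕ}
    (h' : BRW.IsDrivenBy P a p jump' offspring') (n : ℤ) :
    BRW.tailProb P jump' offspring' n = BRW.tailProb P jump offspring n := by
  have key : ∀ {jump : List ℕ → Ω → ℤ} {offspring : List ℕ → Ω → ℕ},
      BRW.IsDrivenBy P a p jump offspring → BRW.tailProb P jump offspring n =
      (Measure.infinitePi fun _ : List ℕ => a.toMeasure.prod p.toMeasure).real
        {x | Reaches (fun v (x : List ℕ → ℤ × ℕ) => (x v).1) (fun v x => (x v).2) n x} := by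
    intro jump offspring h
    have hm : ∀ v, Measurable fun ω => (jump v ω, offspring v ω) := fun v =>
      (h.measurable_jump v).prodMk (h.measurable_offspring v)
    have hlaw := h.indep.map_fun_eq_infinitePi_map hm
    simp only [h.law] at hlaw
    rw [← hlaw, map_measureReal_apply (measurable_pi_iff.2 hm), tailProb_eq]
    · have hT : ∀ ω v, BRW.InTree (fun v (x : List ℕ → ℤ × ℕ) => (x v).2)
          (fun v => (jump v ω, offspring v ω)) v ↔ BRW.InTree offspring ω v := by
        intro ω v
        induction v with
        | nil => rfl
        | cons i v ih => simp only [BRW.InTree, ih]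
      have hpos : ∀ ω v, BRW.position (fun v (x : List ℕ → ℤ × ℕ) => (x v).1)
          (fun v => (jump v ω, offspring v ω)) v = BRW.position jump ω v := by
        intro ω v
        induction v with
        | nil => rfl
        | cons i v ih => simp only [BRW.position, ih]
      simp only [Reaches, Set.preimage_ofPred_eq, hT, hpos]
    · exact measurableSet_reaches (fun v => by fun_prop) (fun v => by fun_prop) n
  rw [key h, key h']

/-- On the event that the root jumps by `y` and has `j` children, level `n` is not reached exactly
when none of the `j` independent subtrees reaches level `n - y`. -/
theorem isTailSolution_tailProb [IsProbabilityMeasure P] (h : BRW.IsDrivenBy P a p jump offspring) :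
    IsTailSolution (fun y => (a y).toReal) (survivalMap p) (BRW.tailProb P jump offspring) where
  nonneg _ := measureReal_nonneg
  le_one _ := measureReal_le_one
  eq_one n hn := by
    have : {ω | Reaches jump offspring n ω} = Set.univ :=
      Set.eq_univ_of_forall fun ω => ⟨[], trivial, hn⟩
    rw [tailProb_eq, this, probReal_univ]
  hasSum n hn := by
    set u := BRW.tailProb P jump offspring with hu
    set X : List ℕ → Ω → ℤ × ℕ := fun v ω => (jump v ω, offspring v ω) with hX
    have hXm : ∀ v, Measurable (X v) := fun v =>
      (h.measurable_jump v).prodMk (h.measurable_offspring v)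
    let sub : ℕ → ℤ → Set Ω := fun i k =>
      {ω | Reaches (fun w => jump (w ++ [i])) (fun w => offspring (w ++ [i])) k ω}
    have hmeas : MeasurableSet {ω | Reaches jump offspring n ω} :=
      measurableSet_reaches h.measurable_jump h.measurable_offspring n
    have hroot : ∀ b : ℤ × ℕ, P.real ({ω | Reaches jump offspring n ω}ᶜ ∩ X [] ⁻¹' {b}) =
        (a b.1).toReal * ((p b.2).toReal * (1 - u (n - b.1)) ^ b.2) := by
      rintro ⟨y, j⟩
      have hset : {ω | Reaches jump offspring n ω}ᶜ ∩ X [] ⁻¹' {(y, j)} =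
          X [] ⁻¹' {(y, j)} ∩ ⋂ i < j, (sub i (n - y))ᶜ := by
        ext ω
        simp only [Set.mem_inter_iff, Set.mem_compl_iff, Set.mem_ofPred_eq, Set.mem_preimage,
          Set.mem_singleton_iff, Set.mem_iInter, hX, Prod.mk.injEq, reaches_iff hn, sub]
        constructor
        · rintro ⟨h1, rfl, rfl⟩
          exact ⟨⟨rfl, rfl⟩, fun i hi hr => h1 ⟨i, hi, hr⟩⟩
        · rintro ⟨⟨rfl, rfl⟩, h1⟩
          exact ⟨fun ⟨i, hi, hr⟩ => h1 i hi hr, rfl, rfl⟩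
      rw [hset, measureReal_inter_iInter_of_iIndep
        (m := fun v => MeasurableSpace.comap (X v) inferInstance) (fun v => (hXm v).comap_le)
        h.indep (S := fun i => Set.range fun w => w ++ [i]) (T := {[]})
        (D := X [] ⁻¹' {(y, j)}) (A := fun i => (sub i (n - y))ᶜ) (q := 1 - u (n - y))]
      · have : P.real (X [] ⁻¹' {(y, j)}) = (a y).toReal * (p j).toReal := by
          rw [← map_measureReal_apply (hXm []) (measurableSet_singleton _), h.law [],
            ← Set.singleton_prod_singleton, measureReal_prod_prod, measureReal_def,
            measureReal_def, PMF.toMeasure_apply_singleton _ _ (measurableSet_singleton _),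
            PMF.toMeasure_apply_singleton _ _ (measurableSet_singleton _)]
        rw [this, mul_assoc]
      · intro i k hik
        refine Set.disjoint_left.2 ?_
        rintro _ ⟨w, rfl⟩ ⟨w', hw⟩
        exact hik (by simpa using (List.append_inj' hw rfl).2.symm)
      · intro i
        refine Set.disjoint_left.2 ?_
        rintro _ rfl ⟨w, hw⟩
        simp at hw
      · rw [iSup_singleton]
        exact ⟨_, measurableSet_singleton _, rfl⟩
      · intro i
        have hle : ∀ w : List ℕ, Measurable[⨆ v ∈ Set.range fun w : List ℕ => w ++ [i],
            MeasurableSpace.comap (X v) inferInstance] (X (w ++ [i])) := fun w =>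
          (comap_measurable (X (w ++ [i]))).mono
            (le_iSup₂ (f := fun v (_ : v ∈ Set.range fun w : List ℕ => w ++ [i]) =>
              MeasurableSpace.comap (X v) inferInstance) (w ++ [i]) ⟨w, rfl⟩) le_rfl
        refine MeasurableSet.compl ?_
        exact measurableSet_reaches (fun w => measurable_fst.comp (hle w))
          (fun w => measurable_snd.comp (hle w)) _
      · intro i
        rw [probReal_compl_eq_one_sub (measurableSet_reaches (fun w => h.measurable_jump _)
          (fun w => h.measurable_offspring _) _), ← tailProb_eq,
          tailProb_eq_of_isDrivenBy h (isDrivenBy_subtree h i)]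
    have hsum := hasSum_measureReal_inter_preimage (P := P) (hXm []) hmeas.compl
    simp only [hroot] at hsum
    rw [probReal_compl_eq_one_sub hmeas, ← tailProb_eq] at hsum
    have h1 : HasSum (fun y => (a y).toReal * ∑' j, (p j).toReal * (1 - u (n - y)) ^ j)
        (1 - u n) := by
      refine hsum.prod_fiberwise fun y => ?_
      refine (summable_pmf_mul_pow p ?_ ?_).hasSum.mul_left _
      · have : u (n - y) ≤ 1 := measureReal_le_one
        linarith
      · have : 0 ≤ u (n - y) := measureReal_nonneg
        linarith
    have h2 := (hasSum_toReal_pmf a).sub h1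
    simpa only [survivalMap, mul_sub, mul_one, sub_sub_cancel] using h2

end TreeLaw

/-! ### The discounted passage time of the random walk -/

section Walk

variable {Ω : Type*} {Y : ℕ → Ω → ℤ}

lemma passageTime_eq_coe_iff (n : ℤ) (ω : Ω) (k : ℕ) : BRW.passageTime Y n ω = WithTop.some k ↔
    n ≤ BRW.walk Y k ω ∧ ∀ j < k, BRW.walk Y j ω < n := by
  rw [BRW.passageTime, hittingAfter_def]
  simp only [zero_le, true_and, Set.mem_Ici]
  split_ifs with h
  · obtain ⟨j, -, hj⟩ := h
    have h : {i | n ≤ BRW.walk Y i ω}.Nonempty := ⟨j, hj⟩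
    rw [WithTop.coe_inj]
    constructor
    · rintro rfl
      exact ⟨Nat.sInf_mem h,
        fun j hj => not_le.1 (Nat.notMem_of_lt_sInf (s := {i | n ≤ BRW.walk Y i ω}) hj)⟩
    · rintro ⟨h1, h2⟩
      refine le_antisymm (Nat.sInf_le h1) ?_
      by_contra! hlt
      exact absurd (Nat.sInf_mem h) (not_le.2 (h2 _ hlt))
  · constructor
    · intro h2
      exact absurd h2 (WithTop.top_ne_coe)
    · rintro ⟨h1, -⟩
      exact absurd ⟨k, Nat.zero_le _, h1⟩ h

lemma passageTime_eq_top_iff (n : ℤ) (ω : Ω) : BRW.passageTime Y n ω = ⊤ ↔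
    ∀ j, BRW.walk Y j ω < n := by
  constructor
  · intro h j
    by_contra! hj
    rw [BRW.passageTime, hittingAfter_def] at h
    simp only [zero_le, true_and, Set.mem_Ici] at h
    rw [if_pos ⟨j, Nat.zero_le _, hj⟩] at h
    exact absurd h WithTop.coe_ne_top
  · intro h
    by_contra hne
    obtain ⟨k, hk⟩ := WithTop.ne_top_iff_exists.1 hne
    exact absurd ((passageTime_eq_coe_iff n ω k).1 hk.symm).1 (not_le.2 (h k))

lemma measurable_walk {mΩ : MeasurableSpace Ω} (hY : ∀ i, Measurable (Y i)) (k : ℕ) :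
    Measurable (BRW.walk Y k) :=
  Finset.measurable_fun_sum _ fun i _ => hY i

lemma measurable_powTop_passageTime {mΩ : MeasurableSpace Ω} (hY : ∀ i, Measurable (Y i)) (m : ℝ)
    (n : ℤ) : Measurable fun ω => BRW.powTop m (BRW.passageTime Y n ω) := by
  let _ : MeasurableSpace (WithTop ℕ) := ⊤
  have h1 : Measurable (BRW.passageTime Y n) := by
    have : Countable (WithTop ℕ) := inferInstanceAs (Countable (Option ℕ))
    refine measurable_to_countable' fun t => ?_
    induction t with
    | top =>
      have : BRW.passageTime Y n ⁻¹' {⊤} = ⋂ j, {ω | BRW.walk Y j ω < n} := by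
        ext ω; simp [passageTime_eq_top_iff]
      rw [this]
      exact MeasurableSet.iInter fun j => measurableSet_lt (measurable_walk hY j) measurable_const
    | coe k =>
      have : BRW.passageTime Y n ⁻¹' {WithTop.some k} =
          {ω | n ≤ BRW.walk Y k ω} ∩ ⋂ j < k, {ω | BRW.walk Y j ω < n} := by
        ext ω
        simpa using passageTime_eq_coe_iff n ω k
      rw [this]
      exact (measurableSet_le measurable_const (measurable_walk hY k)).inter
        (MeasurableSet.biInter (Set.to_countable _) fun j _ =>
          measurableSet_lt (measurable_walk hY j) measurable_const)
  exact (measurable_from_top (f := BRW.powTop m)).comp h1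

lemma powTop_mem_Icc {m : ℝ} (h0 : 0 ≤ m) (h1 : m ≤ 1) (t : WithTop ℕ) :
    0 ≤ BRW.powTop m t ∧ BRW.powTop m t ≤ 1 := by
  induction t with
  | top => exact ⟨le_rfl, zero_le_one⟩
  | coe k => exact ⟨pow_nonneg h0 k, pow_le_one₀ h0 h1⟩

lemma walk_succ_eq (k : ℕ) (ω : Ω) :
    BRW.walk Y (k + 1) ω = Y 0 ω + BRW.walk (fun i => Y (i + 1)) k ω := by
  rw [BRW.walk, BRW.walk, Finset.sum_range_succ', add_comm]

lemma passageTime_of_nonpos {n : ℤ} (hn : n ≤ 0) (ω : Ω) :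
    BRW.passageTime Y n ω = WithTop.some 0 := by
  rw [passageTime_eq_coe_iff]
  exact ⟨by simpa [BRW.walk] using hn, fun j hj => absurd hj (Nat.not_lt_zero j)⟩

/-- First-step decomposition of `m ^ τ_n`. -/
lemma powTop_passageTime_succ (m : ℝ) {n : ℤ} (hn : 0 < n) (ω : Ω) :
    BRW.powTop m (BRW.passageTime Y n ω) =
      m * BRW.powTop m (BRW.passageTime (fun i => Y (i + 1)) (n - Y 0 ω) ω) := by
  rcases h : BRW.passageTime (fun i => Y (i + 1)) (n - Y 0 ω) ω with _ | k
  · have h2 : BRW.passageTime Y n ω = ⊤ := by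
      rw [passageTime_eq_top_iff]
      have h3 := (passageTime_eq_top_iff _ _).1 h
      rintro (_ | j)
      · simpa [BRW.walk] using hn
      · rw [walk_succ_eq]; have := h3 j; omega
    rw [h2]
    exact (mul_zero m).symm
  · have h3 := (passageTime_eq_coe_iff _ _ k).1 h
    have h2 : BRW.passageTime Y n ω = WithTop.some (k + 1) := by
      rw [passageTime_eq_coe_iff]
      refine ⟨by rw [walk_succ_eq]; omega, ?_⟩
      rintro (_ | j) hj
      · simpa [BRW.walk] using hn
      · rw [walk_succ_eq]; have := h3.2 j (by omega); omega
    rw [h2]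
    exact pow_succ' m k

end Walk

section WalkLaw

variable {Ω : Type*} [MeasurableSpace Ω] {P : Measure Ω} {a : PMF ℤ}
  {Y : ℕ → Ω → ℤ}

lemma isIIDSteps_shift (h : BRW.IsIIDSteps P a Y) : BRW.IsIIDSteps P a fun i => Y (i + 1) where
  measurable _ := h.measurable _
  law _ := h.law _
  indep := h.indep.precomp (g := fun i => i + 1) (add_left_injective 1)

/-- The discounted passage time depends only on the law of the steps. -/
lemma integral_powTop_eq_of_isIIDSteps (h : BRW.IsIIDSteps P a Y) {Y' : ℕ → Ω → ℤ}
    (h' : BRW.IsIIDSteps P a Y') (m : ℝ) (n : ℤ) :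
    ∫ ω, BRW.powTop m (BRW.passageTime Y' n ω) ∂P =
      ∫ ω, BRW.powTop m (BRW.passageTime Y n ω) ∂P := by
  have key : ∀ {Y : ℕ → Ω → ℤ}, BRW.IsIIDSteps P a Y →
      ∫ ω, BRW.powTop m (BRW.passageTime Y n ω) ∂P =
      ∫ x, BRW.powTop m (BRW.passageTime (fun i (x : ℕ → ℤ) => x i) n x)
        ∂(Measure.infinitePi fun _ : ℕ => a.toMeasure) := by
    intro Y h
    have hlaw := h.indep.map_fun_eq_infinitePi_map h.measurable
    simp only [h.law] at hlaw
    rw [← hlaw, integral_map (measurable_pi_iff.2 h.measurable).aemeasurable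
      (measurable_powTop_passageTime (fun i => measurable_pi_apply i) m n).aestronglyMeasurable]
    rfl
  rw [key h, key h']

theorem isTailSolution_integral_powTop [IsProbabilityMeasure P] {m : ℝ} (hm0 : 0 ≤ m) (hm1 : m ≤ 1)
    (h : BRW.IsIIDSteps P a Y) :
    IsTailSolution (fun y => (a y).toReal) (fun s => m * s)
      (fun n => ∫ ω, BRW.powTop m (BRW.passageTime Y n ω) ∂P) where
  nonneg n := integral_nonneg fun ω => (powTop_mem_Icc hm0 hm1 _).1
  le_one n := by
    have := integral_mono_of_nonneg (μ := P) (ae_of_all _ fun ω =>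
      (powTop_mem_Icc hm0 hm1 (BRW.passageTime Y n ω)).1) (integrable_const (1 : ℝ))
      (ae_of_all _ fun ω => (powTop_mem_Icc hm0 hm1 (BRW.passageTime Y n ω)).2)
    simpa using this
  eq_one n hn := by
    have : ∀ ω, BRW.powTop m (BRW.passageTime Y n ω) = 1 := fun ω => by
      rw [passageTime_of_nonpos hn]; exact pow_zero m
    simp [this]
  hasSum n hn := by
    have hint : ∀ {Z : ℕ → Ω → ℤ} (k : ℤ), (∀ i, Measurable (Z i)) →
        Integrable (fun ω => BRW.powTop m (BRW.passageTime Z k ω)) P := fun k hZ =>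
      Integrable.of_bound (measurable_powTop_passageTime hZ m k).aestronglyMeasurable 1
        (ae_of_all _ fun ω => by
          rw [Real.norm_of_nonneg (powTop_mem_Icc hm0 hm1 _).1]
          exact (powTop_mem_Icc hm0 hm1 _).2)
    have hmeas : ∀ y : ℤ, MeasurableSet (Y 0 ⁻¹' {y}) := fun y =>
      h.measurable 0 (measurableSet_singleton y)
    have hsum := hasSum_integral_iUnion (μ := P) (s := fun y : ℤ => Y 0 ⁻¹' {y}) hmeas
      (fun y z hyz => Set.disjoint_left.2 fun ω hy hz => hyz (hy.symm.trans hz))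
      (hint n h.measurable).integrableOn
    have huniv : ⋃ y : ℤ, Y 0 ⁻¹' {y} = Set.univ := by
      ext ω; simp
    rw [huniv, setIntegral_univ] at hsum
    refine (congrArg (fun f => HasSum f _) (funext fun y => ?_)).mp hsum
    set g : Ω → ℝ := fun ω => BRW.powTop m (BRW.passageTime (fun i => Y (i + 1)) (n - y) ω)
      with hg
    have h1 : ∫ ω in Y 0 ⁻¹' {y}, BRW.powTop m (BRW.passageTime Y n ω) ∂P =
        ∫ ω in Y 0 ⁻¹' {y}, m * g ω ∂P := by
      refine setIntegral_congr_fun (hmeas y) fun ω hω => ?_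
      have hω' : Y 0 ω = y := hω
      simp only [hg]
      rw [powTop_passageTime_succ m hn, hω']
    have hind : IndepFun ((Y 0 ⁻¹' {y}).indicator fun _ => (1 : ℝ)) g P := by
      rw [IndepFun_iff_Indep]
      have hdisj : Disjoint ({0} : Set ℕ) (Set.range fun i : ℕ => i + 1) := by
        rw [Set.disjoint_singleton_left]
        rintro ⟨i, hi⟩
        exact Nat.succ_ne_zero i hi
      have hI := indep_iSup_of_disjoint (fun i => (h.measurable i).comap_le) h.indep hdisj
      have hle : ∀ i : ℕ, Measurable[⨆ v ∈ Set.range fun i : ℕ => i + 1,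
          MeasurableSpace.comap (Y v) inferInstance] (Y (i + 1)) := fun i =>
        (comap_measurable (Y (i + 1))).mono
          (le_iSup₂ (f := fun v (_ : v ∈ Set.range fun i : ℕ => i + 1) =>
            MeasurableSpace.comap (Y v) inferInstance) (i + 1) ⟨i, rfl⟩) le_rfl
      refine indep_of_indep_of_le_left (indep_of_indep_of_le_right hI ?_) ?_
      · exact (measurable_powTop_passageTime hle m (n - y)).comap_le
      · rw [iSup_singleton]
        refine Measurable.comap_le ?_
        exact measurable_const.indicator ⟨_, measurableSet_singleton y, rfl⟩
    have h2 : ∫ ω in Y 0 ⁻¹' {y}, g ω ∂P = (a y).toReal * ∫ ω, g ω ∂P := by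
      have h3 : (fun ω => (Y 0 ⁻¹' {y}).indicator (fun _ => (1 : ℝ)) ω * g ω) =
          (Y 0 ⁻¹' {y}).indicator g := by
        ext ω
        by_cases hω : ω ∈ Y 0 ⁻¹' {y} <;> simp [hω]
      rw [← integral_indicator (hmeas y), ← h3, hind.integral_fun_mul_eq_mul_integral
        (measurable_const.indicator (hmeas y)).aestronglyMeasurable
        (measurable_powTop_passageTime (isIIDSteps_shift h).measurable m _).aestronglyMeasurable,
        integral_indicator_const _ (hmeas y), smul_eq_mul, mul_one,
        ← map_measureReal_apply (h.measurable 0) (measurableSet_singleton y), h.law 0,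
        measureReal_def, PMF.toMeasure_apply_singleton _ _ (measurableSet_singleton _)]
    rw [h1, integral_const_mul, h2, hg, integral_powTop_eq_of_isIIDSteps h (isIIDSteps_shift h)]
    ring

end WalkLaw

/-! ### The decay rate -/

lemma tendsto_neg_log_div {v : ℕ → ℝ} {ε ρ : ℝ} (hε : 0 < ε) (hρ : 0 < ρ)
    (hlow : ∀ n : ℕ, 0 < n → ε * ρ ^ (-(n : ℤ)) ≤ v n) (hup : ∀ n : ℕ, v n ≤ ρ ^ (-(n : ℤ))) :
    Tendsto (fun n : ℕ => -(Real.log (v n) / n)) atTop (𝓝 (Real.log ρ)) := by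
  have hlim : Tendsto (fun n : ℕ => Real.log ρ - Real.log ε / n) atTop (𝓝 (Real.log ρ)) := by
    simpa using tendsto_const_nhds.sub (tendsto_const_div_atTop_nhds_zero_nat (Real.log ε))
  refine tendsto_of_tendsto_of_tendsto_of_le_of_le' tendsto_const_nhds hlim ?_ ?_
  · filter_upwards [eventually_gt_atTop 0] with n hn
    have hn' : (0 : ℝ) < n := by exact_mod_cast hn
    have hv : 0 < v n := (mul_pos hε (zpow_pos hρ _)).trans_le (hlow n hn)
    have h1 := Real.log_le_log hv (hup n)
    rw [Real.log_zpow] at h1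
    push_cast at h1
    rw [← neg_div, le_div_iff₀ hn']
    linarith
  · filter_upwards [eventually_gt_atTop 0] with n hn
    have hn' : (0 : ℝ) < n := by exact_mod_cast hn
    have h1 := Real.log_le_log (mul_pos hε (zpow_pos hρ _)) (hlow n hn)
    rw [Real.log_mul hε.ne' (zpow_pos hρ _).ne', Real.log_zpow] at h1
    push_cast at h1
    rw [← neg_div, div_le_iff₀ hn', sub_mul, div_mul_cancel₀ _ hn'.ne']
    linarith

theorem theorem1 {Ω Ω' : Type*} [MeasurableSpace Ω] [MeasurableSpace Ω']
    (P : Measure Ω) [IsProbabilityMeasure P] (P' : Measure Ω') [IsProbabilityMeasure P']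
    (a : PMF ℤ) (ha : BRW.JumpLaw a) (p : PMF ℕ) (m : ℝ) (hp : BRW.OffspringLaw p m)
    (jump : List ℕ → Ω → ℤ) (offspring : List ℕ → Ω → ℕ)
    (hX : BRW.IsDrivenBy P a p jump offspring)
    (Y : ℕ → Ω' → ℤ) (hY : BRW.IsIIDSteps P' a Y) :
    ∃ ρ : ℝ,
      (1 < ρ ∧ BRW.jumpPgf a ρ = 1 / m ∧
        ∀ s : ℝ, 1 < s → BRW.jumpPgf a s = 1 / m → s = ρ) ∧
      (0 < liminf (fun n : ℕ =>
            ((ρ ^ n * BRW.tailProb P jump offspring (n : ℤ) : ℝ) : EReal)) atTop ∧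
        liminf (fun n : ℕ =>
            ((ρ ^ n * BRW.tailProb P jump offspring (n : ℤ) : ℝ) : EReal)) atTop ≤
          limsup (fun n : ℕ =>
            ((ρ ^ n * BRW.tailProb P jump offspring (n : ℤ) : ℝ) : EReal)) atTop ∧
        limsup (fun n : ℕ =>
            ((ρ ^ n * BRW.tailProb P jump offspring (n : ℤ) : ℝ) : EReal)) atTop ≤ 1) ∧
      (∀ R : ℕ, BRW.HasRightRange a R → BRW.NearlyRightContinuous a R →
        ∃ κ : ℝ, 0 < κ ∧ κ ≤ 1 ∧
          Tendsto (fun n : ℕ => ρ ^ n * BRW.tailProb P jump offspring (n : ℤ)) atTop (𝓝 κ)) ∧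
      Tendsto (fun n : ℕ =>
          -(Real.log (∫ ω, BRW.powTop m (BRW.passageTime Y (n : ℤ) ω) ∂P') / (n : ℝ)))
        atTop (𝓝 (Real.log ρ)) := by
  have h0 : ∀ y, 0 ≤ (a y).toReal := fun y => ENNReal.toReal_nonneg
  have h1 := hasSum_toReal_pmf a
  have hm0 := hp.mean_pos
  have hm1 := hp.mean_lt_one
  have hinv : 1 < 1 / m := by rwa [lt_div_iff₀ hm0, one_mul]
  obtain ⟨ρ, hρ, hKρ⟩ := exists_jumpPgf_eq ha hinv
  have hρ0 : 0 < ρ := one_pos.trans hρ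
  have hQ := isDamping_survivalMap hp
  have hC : m ≤ m + ∑' k : ℕ, (p k).toReal * (k : ℝ) ^ 2 :=
    le_add_of_nonneg_right (tsum_nonneg fun k => by positivity)
  have hu := isTailSolution_tailProb hX
  have hv := isTailSolution_integral_powTop hm0.le hm1.le hY
  have hK := hasSum_jumpPgf ha hρ.le
  rw [hKρ] at hK
  have hK₂ := hasSum_jumpPgf ha (one_le_pow₀ hρ.le : 1 ≤ ρ ^ 2)
  have hK₄ := hasSum_jumpPgf ha (one_le_pow₀ hρ.le : 1 ≤ ρ ^ 4)
  have hlt : 1 < m * BRW.jumpPgf a (ρ ^ 2) := by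
    have := jumpPgf_lt_of_lt ha hρ (by nlinarith : ρ < ρ ^ 2) (by rw [hKρ]; exact hinv)
    rwa [hKρ, div_lt_iff₀' hm0] at this
  have hup := hu.le_zpow h0 h1 hm0 hm1 hQ hρ hK
  obtain ⟨ε, hε, hlow⟩ := hu.exists_mul_zpow_le h0 h1 hm0 hm1 hQ hC hρ hK hK₂ hK₄ hlt
  have hl1 : ∀ n : ℕ, ρ ^ n * BRW.tailProb P jump offspring n ≤ 1 := fun n => by
    have := hup n
    rwa [zpow_neg, zpow_natCast, ← one_div, le_div_iff₀' (pow_pos hρ0 n)] at this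
  have hlε : ∀ n : ℕ, 0 < n → ε ≤ ρ ^ n * BRW.tailProb P jump offspring n := fun n hn => by
    have := hlow n (by exact_mod_cast hn)
    rwa [zpow_neg, zpow_natCast, ← div_eq_mul_inv, div_le_iff₀' (pow_pos hρ0 n)] at this
  refine ⟨ρ, ⟨hρ, hKρ, fun s hs hKs => ?_⟩, ⟨?_, ?_, ?_⟩, fun R hR hcont => ?_, ?_⟩
  · rcases lt_trichotomy s ρ with h | h | h
    · have := jumpPgf_lt_of_lt ha hs h (by rw [hKs]; exact hinv)
      rw [hKs, hKρ] at this
      exact absurd this (lt_irrefl _)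
    · exact h
    · have := jumpPgf_lt_of_lt ha hρ h (by rw [hKρ]; exact hinv)
      rw [hKs, hKρ] at this
      exact absurd this (lt_irrefl _)
  · refine lt_of_lt_of_le (EReal.coe_pos.2 hε) (le_liminf_of_le (by isBoundedDefault) ?_)
    filter_upwards [eventually_gt_atTop 0] with n hn
    exact EReal.coe_le_coe_iff.2 (hlε n hn)
  · exact liminf_le_limsup
  · refine limsup_le_of_le (by isBoundedDefault) (Eventually.of_forall fun n => ?_)
    exact_mod_cast hl1 n
  · obtain ⟨κ, hκ⟩ := hu.exists_tendsto h0 h1 hm0 hm1 hQ hC hρ hK hK₂ hlt hR.1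
      (fun y hy => by rw [hR.2.2 y hy, ENNReal.toReal_zero])
      (fun i hi hiR => ENNReal.toReal_pos (hcont i hi hiR) (a.apply_ne_top _))
    have hκ' : Tendsto (fun n : ℕ => ρ ^ n * BRW.tailProb P jump offspring (n : ℤ)) atTop
        (𝓝 κ) := by
      simpa only [Function.comp_def, zpow_natCast] using hκ.comp tendsto_natCast_atTop_atTop
    refine ⟨κ, hε.trans_le (ge_of_tendsto hκ' ?_), le_of_tendsto' hκ' hl1, hκ'⟩
    filter_upwards [eventually_gt_atTop 0] with n hn using hlε n hn
  · refine tendsto_neg_log_div hε hρ0 (fun n hn => ?_) fun n => ?_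
    · exact (hlow n (by exact_mod_cast hn)).trans (hu.le_linear h0 h1 hm0 hm1 hQ hv n)
    · exact hv.le_zpow h0 h1 hm0 hm1 (isDamping_linear hm0.le) hρ hK n
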